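/- For a cardinal $\Theta$ let $H(\Theta)$ be the collection of all sets whose transitive closure has cardinality $<\Theta$. Regular cardinals are infinite. For a set $M$ and a regular cardinal $\tau$, say that $M$ is weakly $\tau$-closed if for every $I\subseteq M$ with $|I|=\tau$ there is $J\subseteq I$ with $|J|=\tau$ such that every $K\subseteq J$ with $|K|<\tau$ is an element of $M$; and that $M$ is weakly closed if it is weakly $\tau$-closed for all regular $\tau$. For a limit ordinal $\alpha$, a sequence $\langle M_\xi:\xi<\alpha\rangle$ is an $\in$-chain if $M_\xi\subseteq M_\eta$ and $\langle M_\zeta:\zeta\le\eta\rangle\in M_{\eta+1}$ for all $\xi<\eta<\alpha$; it is continuous if $M_\delta=\bigcup_{\xi<\delta}M_\xi$ for all limit $\delta<\alpha$. Let $\kappa$ be an infinite cardinal. $\mathrm{CECA}_\tau(\kappa)$ is the statement: for every cardinal $\Theta>\kappa$ with $\mathrm{cf}(\Theta)\ge\kappa$ (in particular for every regular $\Theta>\kappa$), every set $A\subseteq H(\Theta)$ with $|A|=\kappa$ and every $B\in H(\Theta)$ with $|B|<\kappa$, there is a continuous $\in$-chain $\langle M_\xi:\xi<\mathrm{cf}(\kappa)\rangle$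 of weakly $\tau$-closed elementary submodels of $(H(\Theta),\in)$ such that $|M_\xi|<\kappa$ for all $\xi<\mathrm{cf}(\kappa)$, $B\in M_0$, and $A\subseteq\bigcup_{\xi<\mathrm{cf}(\kappa)}M_\xi$. $\mathrm{CECA}(\kappa)$ is the same statement with "weakly closed" in place of "weakly $\tau$-closed". For a regular uncountable cardinal $\kappa$, let $I[\kappa]$ be the family of all $A\subseteq\kappa$ such that $\{\delta\in A:\delta=\mathrm{cf}(\delta)\}$ is not stationary in $\kappa$ and there is a sequence $\langle\mathcal P_\alpha:\alpha<\kappa\rangle$ such that each $\mathcal P_\alpha$ is a family of fewer than $\kappa$ subsets of $\alpha$, and for every limit ordinal $\alpha\in A$ with $\mathrm{cf}(\alpha)<\alpha$ there is $x\subseteq\alpha$ with $\mathrm{otp}(x)<\alpha=\sup x$ and $x\cap\beta\in\bigcup_{\gamma<\alpha}\mathcal P_\gamma$ for all $\beta<\alpha$. Let $S^{\kappa}_\tau=\{\alpha<\kappa:\mathrm{cf}(\alpha)=\tau\}$. Let $\lambda$ be a singular strong limit cardinal. Then the following are equivalent: (a) $\lambda^+\in I[\lambda^+]$; (b) $S^{\lambda^+}_\tau\in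 I[\lambda^+]$ for all regular $\tau<\lambda$; (c) $\mathrm{CECA}(\lambda^+)$; (d) $\mathrm{CECA}_\tau(\lambda^+)$ for all regular $\tau<\lambda$. -/

import Mathlib

open Cardinal Ordinal Set

universe u

namespace ClosedChain

/-! ### The approachability ideal -/

/-- `I[κ]`, as a family of subsets of `κ` (the ordinals below `κ.ord`).  Intended for `κ` regular
uncountable.  Ordinals of the universe `u` form a type in `u + 1`, hence the lifts. -/
def approachabilityIdeal (κ : Cardinal.{u}) : Set (Set Ordinal.{u}) :=
  {A | A ⊆ Iio κ.ord ∧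
    ¬ IsStationary {δ : Iio κ.ord | δ.1 ∈ A ∧ δ.1 = δ.1.cof.ord} ∧
    ∃ P : Ordinal.{u} → Set (Set Ordinal.{u}),
      (∀ α < κ.ord, #(P α) < Cardinal.lift.{u + 1} κ ∧ ∀ y ∈ P α, y ⊆ Iio α) ∧
      ∀ α ∈ A, Order.IsSuccLimit α → α.cof.ord < α →
        ∃ x : Set Ordinal.{u}, x ⊆ Iio α ∧
          Ordinal.type ((· < ·) : x → x → Prop) < Ordinal.lift.{u + 1} α ∧
          IsLUB x α ∧
          ∀ β < α, ∃ γ < α, x ∩ Iio β ∈ P γ}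

/-- `S^κ_τ`, the set of ordinals below `κ` of cofinality `τ`. -/
def cofSet (κ τ : Cardinal.{u}) : Set Ordinal.{u} :=
  {α | α < κ.ord ∧ α.cof = τ}

/-! ### `H(Θ)` and its elementary submodels -/

/-- The transitive closure of `x`: the elements of `x`, their elements, and so on. -/
def trcl (x : ZFSet.{u}) : Set ZFSet.{u} :=
  {y | Relation.TransGen (· ∈ ·) y x}

/-- `H(Θ)`, the collection of sets whose transitive closure has cardinality less than `Θ`. -/
def H (Θ : Cardinal.{u}) : Set ZFSet.{u} :=
  {x | #(trcl x) < Cardinal.lift.{u + 1} Θ}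

/-- The relation symbols of the language of set theory: one binary symbol. -/
inductive SetRel : ℕ → Type
  | mem : SetRel 2

/-- The first-order language of set theory. -/
def setLanguage : FirstOrder.Language.{0, 0} := ⟨fun _ => Empty, SetRel⟩

/-- A collection of sets as a structure, the relation symbol being interpreted as membership. -/
instance memStructure (X : Set ZFSet.{u}) : setLanguage.Structure X where
  funMap := fun f => Empty.elim f
  RelMap := fun {_} R =>
    match R with
    | SetRel.mem => fun v => (v 0).1 ∈ (v 1).1

/-- `M` is (the underlying set of) an elementary submodel of `(H(Θ), ∈)`. -/
def IsElementarySubmodel (M : ZFSet.{u}) (Θ : Cardinal.{u}) : Prop :=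
  (∀ x ∈ M, x ∈ H Θ) ∧
    ∃ S : setLanguage.ElementarySubstructure (H Θ), ∀ x : H Θ, x ∈ S ↔ x.1 ∈ M

/-! ### Weakly closed sets, chains, and the axioms -/

/-- `M` is weakly `τ`-closed: every `I ∈ [M]^τ` has a subset `J ∈ [I]^τ` with `[J]^{<τ} ⊆ M`. -/
def WeaklyClosedAt (τ : Cardinal.{u}) (M : ZFSet.{u}) : Prop :=
  ∀ I : ZFSet.{u}, I ⊆ M → I.card = τ →
    ∃ J : ZFSet.{u}, J ⊆ I ∧ J.card = τ ∧ ∀ K : ZFSet.{u}, K ⊆ J → K.card < τ → K ∈ M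

/-- `M` is weakly closed: it is weakly `τ`-closed for all regular cardinals `τ`. -/
def WeaklyClosed (M : ZFSet.{u}) : Prop :=
  ∀ τ : Cardinal.{u}, τ.IsRegular → WeaklyClosedAt τ M

/-- The sequence `⟨M_ξ : ξ ≤ η⟩` as a set, namely the function with the von Neumann ordinal `η + 1`
as domain, i.e. the set of the ordered pairs `(ξ, M_ξ)` with `ξ ≤ η`. -/
noncomputable def initialSegment (M : Ordinal.{u} → ZFSet.{u}) (η : Ordinal.{u}) : ZFSet.{u} :=
  ZFSet.range fun ξ : Iic η => ZFSet.pair ξ.1.toZFSet (M ξ.1)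

/-- `⟨M_ξ : ξ < α⟩` is an `∈`-chain.  It is meant for limit ordinals `α`, where `η < α` implies
`η + 1 < α`; the values of `M` outside of `α` are irrelevant then. -/
def IsMemChain (α : Ordinal.{u}) (M : Ordinal.{u} → ZFSet.{u}) : Prop :=
  ∀ ξ η : Ordinal.{u}, ξ < η → η < α → M ξ ⊆ M η ∧ initialSegment M η ∈ M (η + 1)

/-- `⟨M_ξ : ξ < α⟩` is continuous: unions are taken at limits. -/
def IsContinuous (α : Ordinal.{u}) (M : Ordinal.{u} → ZFSet.{u}) : Prop :=
  ∀ δ < α, Order.IsSuccLimit δ → ∀ x : ZFSet.{u}, x ∈ M δ ↔ ∃ ξ < δ, x ∈ M ξ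

/-- The axiom for `κ` whose models are required to have the closure property `C`.
The sets `A` and `B` are taken inside `H(Θ)`, and `Θ` is such that `H(Θ)` contains all its subsets
of cardinality less than `κ`, i.e. `cf(Θ) ≥ κ` (in particular `Θ` may be any regular cardinal
greater than `κ`). -/
def ClosedChainAxiom (C : ZFSet.{u} → Prop) (κ : Cardinal.{u}) : Prop :=
  ∀ Θ : Cardinal.{u}, κ < Θ → κ ≤ Θ.ord.cof →
    ∀ A B : ZFSet.{u}, (∀ a ∈ A, a ∈ H Θ) → B ∈ H Θ → A.card = κ → B.card < κ →
      ∃ M : Ordinal.{u} → ZFSet.{u},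
        IsMemChain κ.ord.cof.ord M ∧
        IsContinuous κ.ord.cof.ord M ∧
        (∀ ξ < κ.ord.cof.ord, IsElementarySubmodel (M ξ) Θ ∧ C (M ξ) ∧ (M ξ).card < κ) ∧
        B ∈ M 0 ∧
        ∀ a ∈ A, ∃ ξ < κ.ord.cof.ord, a ∈ M ξ

/-- The Closed Continuous `∈`-chain Axiom for `κ` and `τ`. -/
def CECAAt (τ κ : Cardinal.{u}) : Prop :=
  ClosedChainAxiom (WeaklyClosedAt τ) κ

/-- The Closed Continuous `∈`-chain Axiom for `κ`. -/
def CECA (κ : Cardinal.{u}) : Prop :=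
  ClosedChainAxiom WeaklyClosed κ

end ClosedChain

/-!
For a singular strong limit cardinal `l` each of the four statements yields the next one in the
cycle (a) → (c) → (d) → (b) → (a); the step (c) → (d) is immediate.

(d) → (b), `cofSet_mem_approachabilityIdeal`: given a chain `M` of weakly `τ`-closed models and `δ`
of cofinality `τ`, let `e ⊆ δ` be cofinal of type `τ`.  Weak closure of `M δ`, applied to the set of
the initial segments of the chain with index in `e`, leaves `τ` many indices `x ⊆ e`; each bounded
part of `x` is coded by an element of `M δ`, hence of some earlier model.  So the sets of indices
coded by elements of `M α` form a witness `⟨P α⟩`.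

(b) → (a), `mem_approachabilityIdeal_of_forall_cofSet`: a limit ordinal below `l⁺` has regular
cofinality less than `l`, as `l` is singular, so the union of the fewer than `l⁺` many witnesses is
a witness.

(a) → (c): as `l` is singular, the approaching sets can be thinned out so that their initial segments
have size less than `l` (`exists_small_approachability`).  The chain is built by recursion.  At
non-limit stages one takes a weakly closed elementary hull (`exists_weaklyClosed_hull`), an
`ω`-union of Löwenheim–Skolem hulls in which each set contains all subsets of the small pieces
`slice _ α`, `α < l`, of the previous one; there are only `l` many such subsets because `l` is a
strong limit.  At limits one has to take unions, and their weak closure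
(`weaklyClosed_of_approachable`) comes from approachability: if `I` has regular size `τ` and no part
of size `τ` in an earlier model, a part of `I` of size less than `τ` is covered by boundedly many
models `M ζ` with `ζ` in the approaching set `x`, and `I` can be shrunk so that a single slice index
`α` suffices for these.  The set `⋃ ζ ∈ x ∩ β, slice (M ζ) α` has size less than `l`, and all its
subsets were added at an earlier stage since `x ∩ β` is guessed there.  In all these arguments
`mk_inter_eq_or_forall_subset` is the pigeonhole principle for regular cardinals.
-/

universe v w

namespace ClosedChain

/-! ### Cardinal arithmetic and a pigeonhole principle -/

theorem mk_biUnion_le_of_le {ι α : Type v} {L : Cardinal.{v}} (hL : ℵ₀ ≤ L) {s : Set ι}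
    {f : ι → Set α} (hs : #s ≤ L) (hf : ∀ i ∈ s, #(f i) ≤ L) : #(⋃ i ∈ s, f i : Set α) ≤ L := by
  refine (mk_biUnion_le f s).trans ?_
  have hsup : ⨆ i : s, #(f i.1) ≤ L := ciSup_le' fun i : s => hf i.1 i.2
  exact (mul_le_mul' hs hsup).trans (mul_eq_self hL).le

theorem mk_union_le_of_le {α : Type v} {L : Cardinal.{v}} (hL : ℵ₀ ≤ L) {s t : Set α}
    (hs : #s ≤ L) (ht : #t ≤ L) : #(s ∪ t : Set α) ≤ L :=
  (mk_union_le s t).trans ((add_le_add hs ht).trans (add_eq_self hL).le)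

theorem lt_lift_succ_iff {l : Cardinal.{u}} {c : Cardinal.{max u v}} :
    c < Cardinal.lift.{v} (Order.succ l) ↔ c ≤ Cardinal.lift.{v} l := by
  rw [Cardinal.lift_succ, Order.lt_succ_iff]

theorem mk_Iio_le_lift {l : Cardinal.{u}} {α : Ordinal.{u}} (h : α < (Order.succ l).ord) :
    #(Iio α) ≤ Cardinal.lift.{u + 1} l := by
  rw [Cardinal.mk_Iio_ordinal, Cardinal.lift_le]
  exact Order.lt_succ_iff.1 (lt_ord.1 h)

theorem mk_Iio_lt_lift {l : Cardinal.{u}} {α : Ordinal.{u}} (h : α < l.ord) :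
    #(Iio α) < Cardinal.lift.{u + 1} l := by
  rw [Cardinal.mk_Iio_ordinal, Cardinal.lift_lt]
  exact lt_ord.1 h

/-- A set of regular size `τ` covered by an increasing family either has a subset of size `τ` inside
one member of the family, or all its subsets of size less than `τ` are inside a member: a small
subset that escapes all members yields fewer than `τ` members that cover the set. -/
theorem mk_inter_eq_or_forall_subset {α : Type v} {ι : Type w} [LinearOrder ι] {τ : Cardinal.{v}}
    (hτ : τ.IsRegular) {X : Set α} (hX : #X = τ) {F : ι → Set α} (hF : Monotone F)
    (hcov : X ⊆ ⋃ i, F i) :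
    (∃ i, #(X ∩ F i : Set α) = τ) ∨
      (∀ i, #(X ∩ F i : Set α) < τ) ∧ ∀ K ⊆ X, #K < τ → ∃ i, K ⊆ F i := by
  by_cases h : ∃ i, #(X ∩ F i : Set α) = τ
  · exact Or.inl h
  have hlt : ∀ i, #(X ∩ F i : Set α) < τ := fun i =>
    lt_of_le_of_ne ((mk_le_mk_of_subset inter_subset_left).trans hX.le) fun h' => h ⟨i, h'⟩
  refine Or.inr ⟨hlt, fun K hK hKτ => ?_⟩
  by_contra! hne
  choose i hi using fun k : K => mem_iUnion.1 (hcov (hK k.2))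
  have hsub : X ⊆ ⋃ k : K, X ∩ F (i k) := by
    intro x hx
    obtain ⟨j, hj⟩ := mem_iUnion.1 (hcov hx)
    obtain ⟨k, hk, hkj⟩ := not_subset.1 (hne j)
    refine mem_iUnion.2 ⟨⟨k, hk⟩, hx, ?_⟩
    rcases le_total j (i ⟨k, hk⟩) with hle | hle
    · exact hF hle hj
    · exact absurd (hF hle (hi ⟨k, hk⟩)) hkj
  have := (card_iUnion_lt_iff_forall_of_isRegular (t := fun k : K => X ∩ F (i k)) hτ hKτ).2
    fun k => hlt _
  exact absurd ((mk_le_mk_of_subset hsub).trans_lt this) (by rw [hX]; exact lt_irrefl _)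

/-! ### Order types of sets of ordinals -/

/-- The order type of the part of `x` below `ξ`. -/
noncomputable def initialType (x : Set Ordinal.{u}) (ξ : Ordinal.{u}) : Ordinal.{u + 1} :=
  Ordinal.type ((· < ·) : (x ∩ Iio ξ : Set Ordinal.{u}) → (x ∩ Iio ξ : Set Ordinal.{u}) → Prop)

theorem initialType_eq_typein (x : Set Ordinal.{u}) (ξ : x) :
    initialType x ξ = typein ((· < ·) : x → x → Prop) ξ := by
  rw [← type_subrel]
  refine type_eq.2 ⟨⟨⟨fun y => ⟨⟨y.1, y.2.1⟩, y.2.2⟩, fun y => ⟨y.1.1, y.1.2, y.2⟩,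
    fun _ => rfl, fun _ => rfl⟩, Iff.rfl⟩⟩

theorem initialType_inter_Iio (x : Set Ordinal.{u}) {ξ β : Ordinal.{u}} (h : ξ < β) :
    initialType (x ∩ Iio β) ξ = initialType x ξ := by
  have : x ∩ Iio β ∩ Iio ξ = x ∩ Iio ξ := by
    ext y
    exact ⟨fun hy => ⟨hy.1.1, hy.2⟩, fun hy => ⟨⟨hy.1, lt_trans hy.2 h⟩, hy.2⟩⟩
  exact le_antisymm (type_mono this.le) (type_mono this.ge)

theorem exists_cofinal_subset (δ : Ordinal.{u}) :
    ∃ e ⊆ Iio δ, #e = Cardinal.lift.{u + 1} δ.cof ∧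
      Ordinal.type ((· < ·) : e → e → Prop) = Ordinal.lift.{u + 1} δ.cof.ord ∧
      (∀ β < δ, ∃ η ∈ e, β ≤ η) ∧
      ∀ β < δ, #(e ∩ Iio β : Set Ordinal.{u}) < Cardinal.lift.{u + 1} δ.cof := by
  obtain ⟨s, hs, hst⟩ := exists_ord_cof_eq (Iio δ)
  rw [Ordinal.cof_Iio, ← lift_cof, ← lift_ord] at hst
  have htype : Ordinal.type ((· < ·) : (Subtype.val '' s : Set Ordinal.{u}) →
      (Subtype.val '' s : Set Ordinal.{u}) → Prop) = Ordinal.lift.{u + 1} δ.cof.ord := by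
    rw [← hst]
    have f : ((· < ·) : s → s → Prop) ≃r ((· < ·) : (Subtype.val '' s : Set Ordinal.{u}) →
        (Subtype.val '' s : Set Ordinal.{u}) → Prop) :=
      ⟨Equiv.Set.image Subtype.val s Subtype.val_injective, Iff.rfl⟩
    exact (type_eq.2 ⟨f⟩).symm
  have hcof : ∀ β < δ, ∃ η ∈ (Subtype.val '' s : Set Ordinal.{u}), β ≤ η := by
    intro β hβ
    obtain ⟨η, hη, hle⟩ := hs ⟨β, hβ⟩
    exact ⟨η.1, ⟨η, hη, rfl⟩, hle⟩
  refine ⟨Subtype.val '' s, ?_, ?_, htype, hcof, ?_⟩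
  · rintro _ ⟨η, -, rfl⟩
    exact η.2
  · have := congrArg Ordinal.card htype
    rwa [card_type, ← lift_card, card_ord] at this
  · intro β hβ
    obtain ⟨η, hη, hle⟩ := hcof β hβ
    refine (mk_le_mk_of_subset (inter_subset_inter_right _ (Iio_subset_Iio hle))).trans_lt ?_
    have h1 : initialType (Subtype.val '' s) η < Ordinal.lift.{u + 1} δ.cof.ord := by
      rw [← htype, initialType_eq_typein _ ⟨η, hη⟩]
      exact typein_lt_type _ _
    rw [lift_ord, lt_ord] at h1
    simpa [initialType] using h1

/-! ### The approachability ideal on a successor of a singular cardinal -/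

theorem cof_lt_of_isSingular {l : Cardinal.{u}} (hl : l.IsSingular) {α : Ordinal.{u}}
    (hα : α < (Order.succ l).ord) : α.cof < l := by
  have hle : α.cof ≤ l := (cof_le_card α).trans (Order.lt_succ_iff.1 (lt_ord.1 hα))
  refine lt_of_le_of_ne hle fun h => hl.not_isRegular ?_
  rw [← h]
  exact isRegular_cof (one_lt_cof_iff.1 (h ▸ one_lt_aleph0.trans_le hl.aleph0_le))

theorem not_isStationary_eq_cof {l : Cardinal.{u}} (h0 : ℵ₀ ≤ l) (A : Set Ordinal.{u}) :
    ¬ IsStationary {δ : Iio (Order.succ l).ord | δ.1 ∈ A ∧ δ.1 = δ.1.cof.ord} := by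
  rw [not_isStationary_iff]
  -- The club is the set of ordinals above `l`, which are not regular cardinals below `l⁺`.
  have hl : l.ord < (Order.succ l).ord := ord_lt_ord.2 (Order.lt_succ l)
  refine ⟨{δ | l.ord < δ.1}, ⟨?_, ?_⟩, ?_⟩
  · rintro t ht hne - a ha
    obtain ⟨b, hb⟩ := hne
    have hlb : l.ord < b.1 := ht hb
    exact hlb.trans_le (ha.1 hb)
  · intro a
    have hlim := isSuccLimit_ord (h0.trans (Order.le_succ l))
    refine ⟨⟨max a.1 (Order.succ l.ord), max_lt a.2 (hlim.succ_lt hl)⟩, ?_,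
      le_max_left a.1 _⟩
    exact (Order.lt_succ l.ord).trans_le (le_max_right _ _)
  · rw [Set.disjoint_left]
    rintro δ ⟨-, hδ⟩ (hlt : l.ord < δ.1)
    have : δ.1.cof ≤ l := (cof_le_card _).trans (Order.lt_succ_iff.1 (lt_ord.1 δ.2))
    rw [hδ] at hlt
    exact absurd (ord_le_ord.2 this) (not_le.2 hlt)

theorem mem_approachabilityIdeal_of_forall_cofSet {l : Cardinal.{u}} (hl : l.IsSingular)
    (h : ∀ τ : Cardinal.{u}, τ.IsRegular → τ < l →
      cofSet (Order.succ l) τ ∈ approachabilityIdeal (Order.succ l)) :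
    Iio (Order.succ l).ord ∈ approachabilityIdeal (Order.succ l) := by
  refine ⟨Subset.rfl, not_isStationary_eq_cof hl.aleph0_le _, ?_⟩
  choose! P hP hx using fun τ hτ hτl => (h τ hτ hτl).2.2
  have hL : ℵ₀ ≤ Cardinal.lift.{u + 1} l := aleph0_le_lift.2 hl.aleph0_le
  refine ⟨fun α => ⋃ τ ∈ {τ : Cardinal.{u} | τ.IsRegular ∧ τ < l}, P τ α, fun α hα => ⟨?_, ?_⟩, ?_⟩
  · rw [lt_lift_succ_iff]
    refine mk_biUnion_le_of_le hL ?_ fun τ hτ => lt_lift_succ_iff.1 (hP τ hτ.1 hτ.2 α hα).1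
    have hinj : #{τ : Cardinal.{u} | τ.IsRegular ∧ τ < l} ≤ #(Iio l.ord) :=
      mk_le_of_injective (f := fun τ => ⟨τ.1.ord, ord_lt_ord.2 τ.2.2⟩)
        fun a b hab => Subtype.ext (ord_injective (Subtype.mk.inj hab))
    exact hinj.trans (by rw [Cardinal.mk_Iio_ordinal, card_ord])
  · intro y hy
    obtain ⟨τ, hτ, hy⟩ := mem_iUnion₂.1 hy
    exact (hP τ hτ.1 hτ.2 α hα).2 y hy
  · intro α hα hlim hcof
    have hreg := isRegular_cof hlim
    have hlt := cof_lt_of_isSingular hl hα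
    obtain ⟨x, hxα, htype, hlub, hγ⟩ := hx α.cof hreg hlt α ⟨hα, rfl⟩ hlim hcof
    refine ⟨x, hxα, htype, hlub, fun β hβ => ?_⟩
    obtain ⟨γ, hγα, hmem⟩ := hγ β hβ
    exact ⟨γ, hγα, mem_iUnion₂.2 ⟨α.cof, ⟨hreg, hlt⟩, hmem⟩⟩

/-- For singular `l` the sets that witness `l⁺ ∈ I[l⁺]` can be taken of size less than `l`, at all
limit ordinals.  At `δ` with `cf(δ) < δ` and a cofinal `x ⊆ δ` of order type `ρ < δ`, keep those
elements of `x` whose position is in a fixed cofinal subset of `ρ` of size `cf(ρ) < l`; the initial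
segments of the thinned set depend only on `ρ` and the initial segments of `x`. -/
theorem exists_small_approachability {l : Cardinal.{u}} (hl : l.IsSingular)
    (h : Iio (Order.succ l).ord ∈ approachabilityIdeal (Order.succ l)) :
    ∃ Q : Ordinal.{u} → Set (Set Ordinal.{u}),
      (∀ α < (Order.succ l).ord, #(Q α) ≤ Cardinal.lift.{u + 1} l ∧
        ∀ z ∈ Q α, z ⊆ Iio α ∧ #z < Cardinal.lift.{u + 1} l) ∧
      ∀ δ < (Order.succ l).ord, Order.IsSuccLimit δ → ∃ x ⊆ Iio δ,
        (∀ β < δ, ∃ ξ ∈ x, β ≤ ξ) ∧ ∀ β < δ, ∃ γ < δ, x ∩ Iio β ∈ Q γ := by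
  obtain ⟨-, -, P, hP, hx⟩ := h
  choose e heρ he_card _ he_cof _ using exists_cofinal_subset.{u}
  have hL : ℵ₀ ≤ Cardinal.lift.{u + 1} l := aleph0_le_lift.2 hl.aleph0_le
  let thin : Set Ordinal.{u} → Ordinal.{u} → Set Ordinal.{u} := fun x ρ =>
    {ξ | ξ ∈ x ∧ ∃ i ∈ e ρ, initialType x ξ = Ordinal.lift.{u + 1} i}
  have hthin : ∀ (x : Set Ordinal.{u}) (ρ β : Ordinal.{u}),
      thin x ρ ∩ Iio β = thin (x ∩ Iio β) ρ := by
    intro x ρ β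
    ext ξ
    constructor
    · rintro ⟨⟨hξ, i, hi, heq⟩, hβ⟩
      exact ⟨⟨hξ, hβ⟩, i, hi, by rwa [initialType_inter_Iio x hβ]⟩
    · rintro ⟨⟨hξ, hβ⟩, i, hi, heq⟩
      exact ⟨⟨hξ, i, hi, by rwa [initialType_inter_Iio x hβ] at heq⟩, hβ⟩
  have hthin_card : ∀ (x : Set Ordinal.{u}) (ρ : Ordinal.{u}), ρ < (Order.succ l).ord →
      #(thin x ρ) < Cardinal.lift.{u + 1} l := by
    intro x ρ hρ
    have hinj : #(thin x ρ) ≤ #(e ρ) := by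
      choose i hi heq using fun ξ : thin x ρ => ξ.2.2
      refine mk_le_of_injective (f := fun ξ => ⟨i ξ, hi ξ⟩) fun a b hab => ?_
      have hab' : i a = i b := Subtype.mk.inj hab
      have := (heq a).trans ((congrArg _ hab').trans (heq b).symm)
      rw [initialType_eq_typein x ⟨a.1, a.2.1⟩, initialType_eq_typein x ⟨b.1, b.2.1⟩] at this
      exact Subtype.ext (Subtype.mk.inj (typein_injective _ this))
    refine hinj.trans_lt ?_
    rw [he_card, Cardinal.lift_lt]
    exact cof_lt_of_isSingular hl hρ
  refine ⟨fun α => {z | (z ⊆ Iio α ∧ #z < Cardinal.lift.{u + 1} l) ∧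
    (z ∈ ({Iio α} : Set (Set Ordinal.{u})) ∪
      ⋃ γ ∈ Iic α, ⋃ ρ ∈ Iic α, (fun p => thin p ρ) '' P γ)},
    fun α hα => ⟨?_, fun z hz => hz.1⟩, fun δ hδ hlim => ?_⟩
  · refine (mk_le_mk_of_subset fun z hz => hz.2).trans (mk_union_le_of_le hL ?_ ?_)
    · rw [mk_singleton]
      exact one_le_aleph0.trans hL
    · have hIic : #(Iic α) ≤ Cardinal.lift.{u + 1} l := by
        rw [← Order.Iio_succ]
        exact mk_Iio_le_lift ((isSuccLimit_ord
          (hl.aleph0_le.trans (Order.le_succ l))).succ_lt hα)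
      refine mk_biUnion_le_of_le hL hIic fun γ hγ => mk_biUnion_le_of_le hL hIic fun ρ _ => ?_
      exact mk_image_le.trans (lt_lift_succ_iff.1 (hP γ (lt_of_le_of_lt hγ hα)).1)
  · rcases lt_or_eq_of_le (ord_cof_le δ) with hcof | hcof
    · obtain ⟨x, hxδ, htype, hlub, hγ⟩ := hx δ hδ hlim hcof
      obtain ⟨ρ, hρδ, hρ⟩ := Ordinal.lt_lift_iff.1 htype
      refine ⟨thin x ρ, fun ξ hξ => hxδ hξ.1, fun β hβ => ?_, fun β hβ => ?_⟩
      · obtain ⟨ξ, hξ, hβξ⟩ : ∃ ξ ∈ x, β < ξ := by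
          by_contra! hcon
          exact absurd (hlub.2 hcon) (not_le.2 hβ)
        have h1 : initialType x ξ < Ordinal.lift.{u + 1} ρ := by
          rw [hρ, initialType_eq_typein x ⟨ξ, hξ⟩]
          exact typein_lt_type _ _
        obtain ⟨j, hj, hjeq⟩ := Ordinal.lt_lift_iff.1 h1
        obtain ⟨i, hi, hji⟩ := he_cof ρ j hj
        have h2 : Ordinal.lift.{u + 1} i < Ordinal.type ((· < ·) : x → x → Prop) := by
          rw [← hρ, Ordinal.lift_lt]
          exact heρ ρ hi
        obtain ⟨ξ', hξ'⟩ := typein_surj _ h2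
        refine ⟨ξ'.1, ⟨ξ'.2, i, hi, by rw [initialType_eq_typein, hξ']⟩, hβξ.le.trans ?_⟩
        have h3 : typein ((· < ·) : x → x → Prop) ⟨ξ, hξ⟩ ≤ typein ((· < ·) : x → x → Prop) ξ' := by
          rw [hξ', ← initialType_eq_typein x ⟨ξ, hξ⟩, ← hjeq, Ordinal.lift_le]
          exact hji
        rw [typein_le_typein] at h3
        exact not_lt.1 h3
      · obtain ⟨γ, hγδ, hmem⟩ := hγ β hβ
        refine ⟨max γ ρ, max_lt hγδ hρδ, ⟨?_, ?_⟩, Or.inr ?_⟩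
        · intro ξ hξ
          rw [hthin] at hξ
          have hξγ : ξ < γ := (hP γ (hγδ.trans hδ)).2 _ hmem hξ.1
          exact hξγ.trans_le (le_max_left _ _)
        · rw [hthin]
          exact hthin_card _ _ (hρδ.trans hδ)
        · rw [hthin]
          exact mem_iUnion₂.2 ⟨γ, le_max_left γ ρ, mem_iUnion₂.2
            ⟨ρ, le_max_right γ ρ, _, hmem, rfl⟩⟩
    · refine ⟨Iio δ, Subset.rfl, fun β hβ => ⟨β, hβ, le_rfl⟩, fun β hβ => ⟨β, hβ, ?_⟩⟩
      have heq : Iio δ ∩ Iio β = Iio β := inter_eq_self_of_subset_right (Iio_subset_Iio hβ.le)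
      have hδl : δ < l.ord := by
        rw [← hcof]
        exact ord_lt_ord.2 (cof_lt_of_isSingular hl hδ)
      rw [heq]
      exact ⟨⟨Subset.rfl, mk_Iio_lt_lift (hβ.trans hδl)⟩, Or.inl rfl⟩

/-! ### Sets of bounded size as elements of `ZFSet` -/

theorem exists_zfset_of_mk_le {l : Cardinal.{u}} {X : Set ZFSet.{u}}
    (hX : #X ≤ Cardinal.lift.{u + 1} l) :
    ∃ x : ZFSet.{u}, (∀ y, y ∈ x ↔ y ∈ X) ∧ x.card ≤ l := by
  have : Small.{u} X := by
    rw [small_iff_lift_mk_lt_univ, Cardinal.lift_id]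
    exact hX.trans_lt (Cardinal.lift_lt_univ l)
  have hmem : ∀ y, y ∈ ZFSet.range (Subtype.val : X → ZFSet.{u}) ↔ y ∈ X := fun y => by simp
  refine ⟨ZFSet.range (Subtype.val : X → ZFSet.{u}), hmem, ?_⟩
  rw [← Cardinal.lift_le.{u + 1}, ← ZFSet.cardinalMk_coe_sort]
  exact (mk_le_mk_of_subset fun y hy => (hmem y).1 hy).trans hX

theorem mk_coe_le {l : Cardinal.{u}} {x : ZFSet.{u}} (hx : x.card ≤ l) :
    #(x : Set ZFSet.{u}) ≤ Cardinal.lift.{u + 1} l :=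
  ZFSet.cardinalMk_coe_sort.trans_le (Cardinal.lift_le.2 hx)

theorem exists_code (x : ZFSet.{u}) :
    ∃ f : ZFSet.{u} → Ordinal.{u}, InjOn f x ∧ ∀ y ∈ x, f y < x.card.ord := by
  have h : #(x : Set ZFSet.{u}) = #(Iio x.card.ord) := by
    rw [Cardinal.mk_Iio_ordinal, card_ord]
    exact ZFSet.cardinalMk_coe_sort
  obtain ⟨f⟩ := Cardinal.eq.1 h
  classical
  refine ⟨fun y => if hy : y ∈ x then (f ⟨y, hy⟩).1 else 0, fun a ha b hb hab => ?_, fun y hy => ?_⟩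
  · have ha' : a ∈ x := ha
    have hb' : b ∈ x := hb
    simp only [ha', hb', dif_pos] at hab
    exact Subtype.mk.inj (f.injective (Subtype.ext hab))
  · simp only [hy, dif_pos]
    exact (f ⟨y, hy⟩).2

/-- A chosen enumeration of `x` in type `|x|`, given as the map from elements to their indices. -/
noncomputable def code (x : ZFSet.{u}) : ZFSet.{u} → Ordinal.{u} :=
  (exists_code x).choose

theorem code_injOn (x : ZFSet.{u}) : InjOn (code x) x :=
  (exists_code x).choose_spec.1

theorem code_lt {x y : ZFSet.{u}} (h : y ∈ x) : code x y < x.card.ord :=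
  (exists_code x).choose_spec.2 y h

/-- The first `α` elements of `x` in the chosen enumeration. -/
def slice (x : ZFSet.{u}) (α : Ordinal.{u}) : Set ZFSet.{u} :=
  {y | y ∈ x ∧ code x y < α}

theorem slice_mono (x : ZFSet.{u}) : Monotone (slice x) :=
  fun _ _ h _ hy => ⟨hy.1, hy.2.trans_le h⟩

theorem mk_slice_le (x : ZFSet.{u}) (α : Ordinal.{u}) : #(slice x α) ≤ #(Iio α) :=
  mk_le_of_injective (f := fun y => ⟨code x y.1, y.2.2⟩) fun a b hab =>
    Subtype.ext (code_injOn x a.2.1 b.2.1 (Subtype.mk.inj hab))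

theorem exists_mem_slice {l : Cardinal.{u}} (hl : ℵ₀ ≤ l) {x y : ZFSet.{u}} (hx : x.card ≤ l)
    (hy : y ∈ x) : ∃ α < l.ord, y ∈ slice x α :=
  ⟨Order.succ (code x y), (isSuccLimit_ord hl).succ_lt ((code_lt hy).trans_le (ord_le_ord.2 hx)),
    hy, Order.lt_succ _⟩

theorem mk_subset_le_of_isStrongLimit {l : Cardinal.{u}} (hlim : l.IsStrongLimit)
    {T : Set ZFSet.{u}} (hT : #T < Cardinal.lift.{u + 1} l) :
    #{K : ZFSet.{u} | (K : Set ZFSet.{u}) ⊆ T} ≤ Cardinal.lift.{u + 1} l := by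
  have h1 : #{K : ZFSet.{u} | (K : Set ZFSet.{u}) ⊆ T} ≤ #(𝒫 T) :=
    mk_le_of_injective (f := fun K => ⟨K.1, K.2⟩) fun a b hab =>
      Subtype.ext (SetLike.coe_injective (Subtype.mk.inj hab))
  refine h1.trans ?_
  rw [mk_powerset]
  obtain ⟨c, hc, hcT⟩ := Cardinal.lt_lift_iff.1 hT
  rw [← hcT, ← Cardinal.lift_two_power, Cardinal.lift_le]
  exact (hlim.isStrongPrelimit hc).le

/-! ### Closure of `H(Θ)` under small subsets -/

theorem mem_H_of_forall_mem {Θ : Cardinal.{u}} (hΘ : ℵ₀ ≤ Θ) {x : ZFSet.{u}}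
    (hx : ∀ y ∈ x, y ∈ H Θ) (hc : x.card < Θ.ord.cof) : x ∈ H Θ := by
  have hsub : trcl x ⊆ ⋃ y : (x : Set ZFSet.{u}), insert y.1 (trcl y.1) := by
    intro z hz
    rcases Relation.TransGen.tail'_iff.1 hz with ⟨y, hzy, hyx⟩
    refine mem_iUnion.2 ⟨⟨y, hyx⟩, ?_⟩
    rcases Relation.reflTransGen_iff_eq_or_transGen.1 hzy with h | h
    · exact Or.inl h.symm
    · exact Or.inr h
  have hL : ℵ₀ ≤ Cardinal.lift.{u + 1} Θ := aleph0_le_lift.2 hΘ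
  have hcof : #(x : Set ZFSet.{u}) < (Cardinal.lift.{u + 1} Θ).ord.cof := by
    rw [← lift_ord, ← lift_cof]
    exact ZFSet.cardinalMk_coe_sort.trans_lt (Cardinal.lift_lt.2 hc)
  refine (mk_le_mk_of_subset hsub).trans_lt ((mk_iUnion_le _).trans_lt
    (mul_lt_of_lt hL (hcof.trans_le (cof_ord_le _)) (iSup_lt_of_lt_cof_ord hcof fun y => ?_)))
  exact mk_insert_le.trans_lt (add_lt_of_lt hL (hx y.1 y.2) (one_lt_aleph0.trans_le hL))

/-- The assumptions on `Θ` under which `H(Θ)` contains its subsets of size at most `l`. -/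
structure IsLarge (l Θ : Cardinal.{u}) : Prop where
  aleph0_le : ℵ₀ ≤ l
  succ_lt : Order.succ l < Θ
  succ_le_cof : Order.succ l ≤ Θ.ord.cof

namespace IsLarge

variable {l Θ : Cardinal.{u}}

theorem mem_H (h : IsLarge l Θ) {x : ZFSet.{u}} (hx : ∀ y ∈ x, y ∈ H Θ) (hc : x.card ≤ l) :
    x ∈ H Θ :=
  mem_H_of_forall_mem (h.aleph0_le.trans ((Order.le_succ l).trans h.succ_lt.le)) hx
    ((Order.lt_succ_iff.2 hc).trans_le h.succ_le_cof)

theorem toZFSet_mem_H (h : IsLarge l Θ) {α : Ordinal.{u}} (hα : α < (Order.succ l).ord) :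
    α.toZFSet ∈ H Θ := by
  induction α using WellFoundedLT.induction with
  | _ α ih =>
    refine h.mem_H (fun y hy => ?_) ?_
    · obtain ⟨β, hβ, rfl⟩ := mem_toZFSet_iff.1 hy
      exact ih β hβ (hβ.trans hα)
    · rw [card_toZFSet]
      exact Order.lt_succ_iff.1 (lt_ord.1 hα)

theorem pair_mem_H (h : IsLarge l Θ) {x y : ZFSet.{u}} (hx : x ∈ H Θ) (hy : y ∈ H Θ) :
    ZFSet.pair x y ∈ H Θ := by
  have key : ∀ a ∈ H Θ, ∀ b ∈ H Θ, ({a, b} : ZFSet.{u}) ∈ H Θ := by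
    intro a ha b hb
    refine h.mem_H (fun z hz => ?_) ?_
    · rcases ZFSet.mem_pair.1 hz with rfl | rfl <;> assumption
    · refine (ZFSet.card_insert_le.trans ?_).trans h.aleph0_le
      rw [ZFSet.card_singleton, one_add_one_eq_two]
      exact_mod_cast (natCast_lt_aleph0 (n := 2)).le
  have hsing : ({x} : ZFSet.{u}) ∈ H Θ := by
    refine h.mem_H (fun z hz => ?_) ?_
    · rw [ZFSet.mem_singleton] at hz
      exact hz ▸ hx
    · rw [ZFSet.card_singleton]
      exact one_le_aleph0.trans h.aleph0_le
  exact key _ hsing _ (key x hx y hy)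

theorem initialSegment_mem_H (h : IsLarge l Θ) {M : Ordinal.{u} → ZFSet.{u}} {η : Ordinal.{u}}
    (hη : η < (Order.succ l).ord) (hM : ∀ ξ ≤ η, (∀ x ∈ M ξ, x ∈ H Θ) ∧ (M ξ).card ≤ l) :
    initialSegment M η ∈ H Θ := by
  refine h.mem_H (fun y hy => ?_) ?_
  · obtain ⟨ξ, rfl⟩ := ZFSet.mem_range.1 hy
    have hξ := hM ξ.1 ξ.2
    exact h.pair_mem_H (h.toZFSet_mem_H (lt_of_le_of_lt ξ.2 hη)) (h.mem_H hξ.1 hξ.2)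
  · have := ZFSet.lift_card_range_le (f := fun ξ : Iic η => ZFSet.pair ξ.1.toZFSet (M ξ.1))
    rw [Cardinal.lift_id'.{u, u + 1}] at this
    rw [← Cardinal.lift_le.{u + 1}]
    refine this.trans ?_
    rw [← Order.Iio_succ]
    exact mk_Iio_le_lift ((isSuccLimit_ord (h.aleph0_le.trans (Order.le_succ l))).succ_lt hη)

end IsLarge

theorem initialSegment_injective (M : Ordinal.{u} → ZFSet.{u}) :
    Function.Injective (initialSegment M) := by
  have key : ∀ {ξ η}, initialSegment M ξ = initialSegment M η → ξ ≤ η := by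
    intro ξ η h
    have hmem : ZFSet.pair ξ.toZFSet (M ξ) ∈ initialSegment M η := by
      rw [← h]
      exact ZFSet.mem_range.2 ⟨⟨ξ, le_refl ξ⟩, rfl⟩
    obtain ⟨ζ, hζ⟩ := ZFSet.mem_range.1 hmem
    rw [← toZFSet_injective (ZFSet.pair_inj.1 hζ).1]
    exact ζ.2
  exact fun ξ η h => le_antisymm (key h) (key h.symm)

/-! ### Elementary submodels -/

theorem card_setLanguage_le : setLanguage.card ≤ ℵ₀ := by
  have hf : ∀ n, Countable (setLanguage.Functions n) := fun n =>
    inferInstanceAs (Countable Empty)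
  have hr : ∀ n, Countable (setLanguage.Relations n) := fun n =>
    have : Subsingleton (SetRel n) := ⟨fun a b => by cases a; cases b; rfl⟩
    inferInstanceAs (Countable (SetRel n))
  have : Countable setLanguage.Symbols :=
    inferInstanceAs (Countable ((Σ n, setLanguage.Functions n) ⊕ Σ n, setLanguage.Relations n))
  exact mk_le_aleph0

theorem exists_elementary_superset {l Θ : Cardinal.{u}} (hl : ℵ₀ ≤ l)
    (hH : Cardinal.lift.{u + 1} l ≤ #(H Θ)) {X : Set ZFSet.{u}} (hX : X ⊆ H Θ)
    (hXl : #X ≤ Cardinal.lift.{u + 1} l) :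
    ∃ M : ZFSet.{u}, X ⊆ M ∧ IsElementarySubmodel M Θ ∧ M.card ≤ l := by
  obtain ⟨S, hXS, hS⟩ := FirstOrder.Language.exists_elementarySubstructure_card_eq setLanguage
    ((Subtype.val : H Θ → ZFSet.{u}) ⁻¹' X) l hl
    (by
      rw [Cardinal.lift_id'.{u, u + 1}]
      exact (mk_preimage_of_injective _ _ Subtype.val_injective).trans hXl)
    (by
      rw [Cardinal.lift_id'.{0, u}]
      exact (Cardinal.lift_le.2 card_setLanguage_le).trans (by simpa using hl))
    (by rwa [Cardinal.lift_id'.{u, u + 1}])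
  rw [Cardinal.lift_id'.{u, u + 1}] at hS
  obtain ⟨M, hM, hMl⟩ := exists_zfset_of_mk_le (l := l) (X := Subtype.val '' (S : Set (H Θ)))
    (mk_image_le.trans hS.le)
  refine ⟨M, fun x hx => (hM x).2 ⟨⟨x, hX hx⟩, hXS hx, rfl⟩, ⟨fun x hx => ?_, S, fun x => ?_⟩, hMl⟩
  · obtain ⟨y, -, rfl⟩ := (hM x).1 hx
    exact y.2
  · rw [hM]
    exact ⟨fun hx => ⟨x, hx, rfl⟩, fun ⟨y, hy, hyx⟩ => Subtype.ext hyx ▸ hy⟩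

/-- The union of an increasing family of elementary submodels is an elementary submodel: the
Tarski–Vaught test only involves finitely many parameters, so one member of the family. -/
theorem isElementarySubmodel_of_monotone {ι : Type v} [LinearOrder ι] [Nonempty ι]
    {Θ : Cardinal.{u}} {N : ι → ZFSet.{u}} (hN : Monotone fun i => (N i : Set ZFSet.{u}))
    (hel : ∀ i, IsElementarySubmodel (N i) Θ) {U : ZFSet.{u}} (hU : ∀ x, x ∈ U ↔ ∃ i, x ∈ N i) :
    IsElementarySubmodel U Θ := by
  refine ⟨fun x hx => ?_, ?_⟩
  · obtain ⟨i, hi⟩ := (hU x).1 hx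
    exact (hel i).1 x hi
  let S : setLanguage.Substructure (H Θ) :=
    { carrier := {x | x.1 ∈ U}
      fun_mem := fun f => Empty.elim f }
  refine ⟨⟨S, S.isElementary_of_exists fun n φ x a ha => ?_⟩, fun x => Iff.rfl⟩
  choose i hi using fun k => (hU (x k).1.1).1 (x k).2
  obtain ⟨j, hj⟩ := Finite.exists_le i
  obtain ⟨-, T, hT⟩ := hel j
  let x' : Fin n → T := fun k => ⟨(x k).1, (hT _).2 (hN (hj k) (hi k))⟩
  have hex : φ.ex.Realize default ((↑) ∘ x' : Fin n → H Θ) :=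
    FirstOrder.Language.BoundedFormula.realize_ex.2 ⟨a, ha⟩
  have hex' : φ.ex.Realize (default : Empty → T) x' := by
    have := T.subtype.map_boundedFormula φ.ex default x'
    refine this.1 ?_
    convert! hex
  obtain ⟨b, hb⟩ := FirstOrder.Language.BoundedFormula.realize_ex.1 hex'
  refine ⟨⟨b.1, (hU _).2 ⟨j, (hT _).1 b.2⟩⟩, ?_⟩
  have := (T.subtype.map_boundedFormula φ default (Fin.snoc x' b)).2 hb
  convert! this using 1
  rw [Fin.comp_snoc]
  rfl

/-! ### Weakly closed sets -/

/-- Weak `τ`-closure in terms of arbitrary subsets of `M`, all of which are sets in `ZFSet`. -/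
theorem weaklyClosedAt_iff {τ : Cardinal.{u}} {M : ZFSet.{u}} :
    WeaklyClosedAt τ M ↔ ∀ I : Set ZFSet.{u}, I ⊆ M → #I = Cardinal.lift.{u + 1} τ →
      ∃ J ⊆ I, #J = Cardinal.lift.{u + 1} τ ∧ ∀ K : ZFSet.{u}, (K : Set ZFSet.{u}) ⊆ J →
        #(K : Set ZFSet.{u}) < Cardinal.lift.{u + 1} τ → K ∈ M := by
  have hcard : ∀ (x : ZFSet.{u}), #(x : Set ZFSet.{u}) = Cardinal.lift.{u + 1} x.card :=
    fun x => ZFSet.cardinalMk_coe_sort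
  have hex : ∀ X : Set ZFSet.{u}, #X = Cardinal.lift.{u + 1} τ →
      ∃ x : ZFSet.{u}, (x : Set ZFSet.{u}) = X ∧ x.card = τ := by
    intro X hX
    obtain ⟨x, hx, -⟩ := exists_zfset_of_mk_le hX.le
    have hxX : (x : Set ZFSet.{u}) = X := Set.ext hx
    refine ⟨x, hxX, ?_⟩
    rw [← hxX, hcard, Cardinal.lift_inj] at hX
    exact hX
  constructor
  · intro h I hIM hI
    obtain ⟨i, rfl, hiτ⟩ := hex I hI
    obtain ⟨j, hji, hjτ, hj⟩ := h i hIM hiτ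
    refine ⟨j, hji, by rw [hcard, hjτ], fun K hK hKτ => hj K hK ?_⟩
    rwa [hcard, Cardinal.lift_lt] at hKτ
  · intro h I hIM hI
    obtain ⟨J, hJI, hJτ, hJ⟩ := h I hIM (by rw [hcard, hI])
    obtain ⟨j, rfl, hjτ⟩ := hex J hJτ
    refine ⟨j, hJI, hjτ, fun K hK hKτ => hJ K hK ?_⟩
    rwa [hcard, Cardinal.lift_lt]

/-- The union of an `ω`-chain is weakly closed if every member contains all small pieces of the
previous one.  A subset of regular size `τ` has a part of size `τ` or, if `τ = ω`, each of its finite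
parts, in one member; and the same dichotomy applies to the enumeration of this member. -/
theorem weaklyClosed_of_nat_chain {l : Cardinal.{u}} (hl : ℵ₀ ≤ l) {N : ℕ → ZFSet.{u}}
    (hN : Monotone fun n => (N n : Set ZFSet.{u})) (hcard : ∀ n, (N n).card ≤ l)
    (hstep : ∀ n, ∀ α < l.ord, ∀ K : ZFSet.{u}, (K : Set ZFSet.{u}) ⊆ slice (N n) α → K ∈ N (n + 1))
    {U : ZFSet.{u}} (hU : ∀ x, x ∈ U ↔ ∃ n, x ∈ N n) : WeaklyClosed U := by
  intro τ hτ
  rw [weaklyClosedAt_iff]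
  intro I hIU hI
  have hτ' : (Cardinal.lift.{u + 1} τ).IsRegular := hτ.lift
  -- The dichotomy inside one member of the chain.
  have key : ∀ (n : ℕ) (X : Set ZFSet.{u}), X ⊆ N n → #X = Cardinal.lift.{u + 1} τ →
      ∃ J ⊆ X, #J = Cardinal.lift.{u + 1} τ ∧ ∀ K : ZFSet.{u}, (K : Set ZFSet.{u}) ⊆ J →
        #(K : Set ZFSet.{u}) < Cardinal.lift.{u + 1} τ → K ∈ U := by
    intro n X hXN hX
    have hcov : X ⊆ ⋃ α : Iio l.ord, slice (N n) α.1 := by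
      intro x hx
      obtain ⟨α, hα, hxα⟩ := exists_mem_slice hl (hcard n) (hXN hx)
      exact mem_iUnion.2 ⟨⟨α, hα⟩, hxα⟩
    rcases mk_inter_eq_or_forall_subset hτ' hX
      (F := fun α : Iio l.ord => slice (N n) α.1) (fun a b hab => slice_mono _ hab) hcov with
      ⟨α, hα⟩ | ⟨-, hα⟩
    · exact ⟨_, inter_subset_left, hα, fun K hK _ =>
        (hU K).2 ⟨n + 1, hstep n α.1 α.2 K (hK.trans inter_subset_right)⟩⟩
    · refine ⟨X, Subset.rfl, hX, fun K hK hKτ => ?_⟩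
      obtain ⟨α, hα⟩ := hα K hK hKτ
      exact (hU K).2 ⟨n + 1, hstep n α.1 α.2 K hα⟩
  rcases mk_inter_eq_or_forall_subset hτ' hI hN
    (fun x hx => mem_iUnion.2 ((hU x).1 (hIU hx))) with ⟨n, hn⟩ | ⟨hlt, hsub⟩
  · obtain ⟨J, hJ, hJτ, hJU⟩ := key n _ inter_subset_right hn
    exact ⟨J, hJ.trans inter_subset_left, hJτ, hJU⟩
  · refine ⟨I, Subset.rfl, hI, fun K hK hKτ => ?_⟩
    have hτω : Cardinal.lift.{u + 1} τ = ℵ₀ := by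
      refine le_antisymm (not_lt.1 fun hω => ?_) hτ'.aleph0_le
      have hle : I ⊆ ⋃ n : ULift.{u + 1} ℕ, I ∩ N n.down := fun x hx => by
        obtain ⟨n, hn⟩ := (hU x).1 (hIU hx)
        exact mem_iUnion.2 ⟨⟨n⟩, hx, hn⟩
      have := (card_iUnion_lt_iff_forall_of_isRegular hτ'
        (t := fun n : ULift.{u + 1} ℕ => I ∩ N n.down) (by simpa using hω)).2 fun n => hlt n.down
      exact absurd ((mk_le_mk_of_subset hle).trans_lt this) (by rw [hI]; exact lt_irrefl _)
    obtain ⟨n, hn⟩ := hsub K hK hKτ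
    have hfin : (K : Set ZFSet.{u}).Finite := by
      rw [hτω] at hKτ
      exact lt_aleph0_iff_set_finite.1 hKτ
    have hex : ∀ x ∈ (K : Set ZFSet.{u}), ∃ α < l.ord, x ∈ slice (N n) α :=
      fun x hx => exists_mem_slice hl (hcard n) (hn hx)
    choose! α hα hxα using hex
    have hpos : 0 < l.ord := (isSuccLimit_ord hl).bot_lt
    obtain ⟨β, hβ, hβα⟩ : ∃ β < l.ord, ∀ x ∈ (K : Set ZFSet.{u}), α x ≤ β := by
      refine ⟨hfin.toFinset.sup α, (Finset.sup_lt_iff hpos).2 fun x hx =>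
        hα x (hfin.mem_toFinset.1 hx), fun x hx => Finset.le_sup (hfin.mem_toFinset.2 hx)⟩
    exact (hU K).2 ⟨n + 1, hstep n β hβ K fun x hx => slice_mono _ (hβα x hx) (hxα x hx)⟩

/-- Every subset of `H(Θ)` of size at most `l` is included in a weakly closed elementary submodel of
size at most `l`. -/
theorem exists_weaklyClosed_hull {l Θ : Cardinal.{u}} (hlim : l.IsStrongLimit) (h : IsLarge l Θ)
    (hH : Cardinal.lift.{u + 1} l ≤ #(H Θ)) {X : Set ZFSet.{u}} (hX : X ⊆ H Θ)
    (hXl : #X ≤ Cardinal.lift.{u + 1} l) :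
    ∃ M : ZFSet.{u}, X ⊆ M ∧ IsElementarySubmodel M Θ ∧ WeaklyClosed M ∧ M.card ≤ l := by
  have hL : ℵ₀ ≤ Cardinal.lift.{u + 1} l := aleph0_le_lift.2 h.aleph0_le
  have hstep : ∀ Y : {Y : ZFSet.{u} // IsElementarySubmodel Y Θ ∧ Y.card ≤ l},
      ∃ Z : {Z : ZFSet.{u} // IsElementarySubmodel Z Θ ∧ Z.card ≤ l}, Y.1 ⊆ Z.1 ∧
        ∀ α < l.ord, ∀ K : ZFSet.{u}, (K : Set ZFSet.{u}) ⊆ slice Y.1 α → K ∈ Z.1 := by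
    rintro ⟨Y, hY, hYl⟩
    have hsmall : ∀ α ∈ Iio l.ord, #{K : ZFSet.{u} | (K : Set ZFSet.{u}) ⊆ slice Y α} ≤
        Cardinal.lift.{u + 1} l := fun α hα =>
      mk_subset_le_of_isStrongLimit hlim ((mk_slice_le Y α).trans_lt (mk_Iio_lt_lift hα))
    obtain ⟨Z, hYZ, hZ, hZl⟩ := exists_elementary_superset h.aleph0_le hH
      (X := Y ∪ ⋃ α ∈ Iio l.ord, {K : ZFSet.{u} | (K : Set ZFSet.{u}) ⊆ slice Y α})
      (by
        rintro x (hx | hx)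
        · exact hY.1 x hx
        · obtain ⟨α, -, hxα⟩ := mem_iUnion₂.1 hx
          have hxY : x ⊆ Y := fun y hy => (hxα hy).1
          exact h.mem_H (fun y hy => hY.1 y (hxY hy)) ((ZFSet.card_mono hxY).trans hYl))
      (mk_union_le_of_le hL (mk_coe_le hYl) (mk_biUnion_le_of_le hL
        (by rw [Cardinal.mk_Iio_ordinal, card_ord]) hsmall))
    exact ⟨⟨Z, hZ, hZl⟩, fun y hy => hYZ (Or.inl hy),
      fun α hα K hK => hYZ (Or.inr (mem_iUnion₂.2 ⟨α, hα, hK⟩))⟩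
  choose next hnext_sub hnext using hstep
  obtain ⟨Y₀, hXY, hY₀, hY₀l⟩ := exists_elementary_superset h.aleph0_le hH hX hXl
  let N : ℕ → {Y : ZFSet.{u} // IsElementarySubmodel Y Θ ∧ Y.card ≤ l} := fun n =>
    Nat.rec ⟨Y₀, hY₀, hY₀l⟩ (fun _ Y => next Y) n
  have hmono : Monotone fun n => ((N n).1 : Set ZFSet.{u}) :=
    monotone_nat_of_le_succ fun n => hnext_sub (N n)
  have hcardU : #(⋃ n : ULift.{u + 1} ℕ, ((N n.down).1 : Set ZFSet.{u}) : Set ZFSet.{u}) ≤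
      Cardinal.lift.{u + 1} l := by
    rw [← biUnion_univ]
    refine mk_biUnion_le_of_le hL (by simpa using hL) fun n _ => mk_coe_le (N n.down).2.2
  obtain ⟨U, hU, hUl⟩ := exists_zfset_of_mk_le hcardU
  have hU' : ∀ x, x ∈ U ↔ ∃ n, x ∈ (N n).1 := fun x =>
    (hU x).trans (mem_iUnion.trans ⟨fun ⟨n, hn⟩ => ⟨n.down, hn⟩, fun ⟨n, hn⟩ => ⟨⟨n⟩, hn⟩⟩)
  exact ⟨U, fun x hx => (hU' x).2 ⟨0, hXY hx⟩,
    isElementarySubmodel_of_monotone hmono (fun n => (N n).2.1) hU',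
    weaklyClosed_of_nat_chain h.aleph0_le hmono (fun n => (N n).2.2)
      (fun n => hnext (N n)) hU', hUl⟩

/-! ### From chains to the approachability ideal -/

/-- The initial segments of a chain of weakly `τ`-closed sets of size at most `l` approach all
ordinals of cofinality `τ`.  For `e ⊆ δ` cofinal of type `τ`, weak closure applied to the initial
segments of the chain with index in `e` leaves `τ` many of them, and these have all their small
subfamilies in `M δ`, hence in `M ξ` for some `ξ < δ`. -/
theorem cofSet_mem_approachabilityIdeal {l τ : Cardinal.{u}} (hl : ℵ₀ ≤ l)
    (h : CECAAt τ (Order.succ l)) :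
    cofSet (Order.succ l) τ ∈ approachabilityIdeal (Order.succ l) := by
  have hκ : ℵ₀ ≤ Order.succ l := hl.trans (Order.le_succ l)
  have hreg : (Order.succ (Order.succ l)).IsRegular := isRegular_succ hκ
  have hlarge : IsLarge l (Order.succ (Order.succ l)) :=
    ⟨hl, Order.lt_succ _, by rw [hreg.cof_ord]; exact Order.le_succ _⟩
  have hempty : (∅ : ZFSet.{u}) ∈ H (Order.succ (Order.succ l)) :=
    hlarge.mem_H (fun y hy => absurd hy (ZFSet.notMem_empty y)) (by simp)
  obtain ⟨M, hchain, hcont, hM, -, -⟩ := h (Order.succ (Order.succ l)) (Order.lt_succ _)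
    hlarge.succ_le_cof (Order.succ l).ord.toZFSet ∅
    (fun a ha => by
      obtain ⟨β, hβ, rfl⟩ := mem_toZFSet_iff.1 ha
      exact hlarge.toZFSet_mem_H hβ)
    hempty (by rw [card_toZFSet, card_ord])
    (by rw [ZFSet.card_empty]; exact (aleph0_pos.trans_le hκ))
  rw [(isRegular_succ hl).cof_ord] at hchain hcont hM
  -- The chain condition does not put the initial segment at `0` into `M 1`, hence the shift.
  let f : Ordinal.{u} → ZFSet.{u} := fun η => initialSegment M (η + 1)
  refine ⟨fun α hα => hα.1, not_isStationary_eq_cof hl _,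
    fun α => (fun K : ZFSet.{u} => {η | η < α ∧ f η ∈ K}) '' (M α : Set ZFSet.{u}),
    fun α hα => ⟨?_, ?_⟩, ?_⟩
  · rw [lt_lift_succ_iff]
    exact mk_image_le.trans (mk_coe_le (Order.lt_succ_iff.1 (hM α hα).2.2))
  · rintro _ ⟨K, -, rfl⟩ η hη
    exact hη.1
  rintro δ ⟨hδ, hδτ⟩ hlim hcof
  obtain ⟨e, heδ, hecard, hetype, -, hesmall⟩ := exists_cofinal_subset δ
  rw [hδτ] at hecard hetype hesmall hcof
  have hinj : Function.Injective f := fun ξ η h =>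
    Order.succ_injective (by simpa using initialSegment_injective M h)
  have hIM : f '' e ⊆ M δ := by
    rintro _ ⟨η, hη, rfl⟩
    have h1 : η + 1 < δ := by
      rw [← Order.succ_eq_add_one]
      exact hlim.succ_lt (heδ hη)
    have h2 : η + 1 + 1 < δ := by
      rw [← Order.succ_eq_add_one]
      exact hlim.succ_lt h1
    refine (hcont δ hδ hlim _).2 ⟨η + 1 + 1, h2, (hchain η (η + 1) ?_ (h1.trans hδ)).2⟩
    rw [← Order.succ_eq_add_one]
    exact Order.lt_succ η
  obtain ⟨J, hJ, hJτ, hJM⟩ := weaklyClosedAt_iff.1 (hM δ hδ).2.1 _ hIM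
    (by rw [mk_image_eq hinj, hecard])
  have hxe : f ⁻¹' J ⊆ e := fun η hη => by
    obtain ⟨ζ, hζ, hζη⟩ := hJ hη
    exact hinj hζη ▸ hζ
  have hJx : f '' (f ⁻¹' J) = J :=
    image_preimage_eq_of_subset (hJ.trans (image_subset_range _ _))
  have hxcard : #(f ⁻¹' J) = Cardinal.lift.{u + 1} τ := by
    rw [← hJτ, ← mk_image_eq hinj, hJx]
  have hxsmall : ∀ β < δ, #(f ⁻¹' J ∩ Iio β : Set Ordinal.{u}) <
      Cardinal.lift.{u + 1} τ := fun β hβ =>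
    (mk_le_mk_of_subset (inter_subset_inter_left _ hxe)).trans_lt (hesmall β hβ)
  refine ⟨f ⁻¹' J, hxe.trans heδ, ?_, ⟨fun η hη => (heδ (hxe hη)).le, fun β hβ => ?_⟩,
    fun β hβ => ?_⟩
  · refine (type_mono hxe).trans_lt ?_
    rw [hetype, Ordinal.lift_lt]
    exact hcof
  · by_contra! hlt
    have hsub : f ⁻¹' J ∩ Iio (Order.succ β) = f ⁻¹' J :=
      inter_eq_self_of_subset_left fun η hη => Order.lt_succ_iff.2 (hβ hη)
    have := hxsmall _ (hlim.succ_lt hlt)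
    rw [hsub, hxcard] at this
    exact lt_irrefl _ this
  · have hKcard : #(f '' (f ⁻¹' J ∩ Iio β)) <
        Cardinal.lift.{u + 1} τ := by
      rw [mk_image_eq hinj]
      exact hxsmall β hβ
    obtain ⟨K, hK, -⟩ := exists_zfset_of_mk_le hKcard.le
    have hKset : (K : Set ZFSet.{u}) = f '' (f ⁻¹' J ∩ Iio β) :=
      Set.ext hK
    have hKM : K ∈ M δ := by
      refine hJM K ?_ (by rw [hKset]; exact hKcard)
      rw [hKset]
      exact (image_mono inter_subset_left).trans hJx.subset
    obtain ⟨ξ, hξ, hKξ⟩ := (hcont δ hδ hlim K).1 hKM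
    have hγ : max ξ β < δ := max_lt hξ hβ
    refine ⟨max ξ β, hγ, K, ?_, ?_⟩
    · rcases eq_or_lt_of_le (le_max_left ξ β) with heq | hlt
      · rwa [← heq]
      · exact (hchain ξ _ hlt (hγ.trans hδ)).1 hKξ
    · ext η
      constructor
      · rintro ⟨-, hη⟩
        obtain ⟨ζ, hζ, hζη⟩ := (hK _).1 hη
        exact hinj hζη ▸ hζ
      · exact fun hη => ⟨hη.2.trans_le (le_max_right _ _), (hK _).2 ⟨η, hη, rfl⟩⟩

/-! ### Chains from approachability -/

/-- Weak closure at a limit `δ` of a chain, given a cofinal `x ⊆ δ` such that the union contains the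
subsets of `⋃ ζ ∈ x ∩ β, slice (M ζ) α`.  A subset of regular size `τ` without a part of size `τ`
inside some `M ξ` is spread out along `x`: give each element a position in `x` and an index in the
enumeration at that position.  Fewer than `τ` elements have bounded positions, and after shrinking
they have bounded indices, too. -/
theorem weaklyClosed_of_approachable {l : Cardinal.{u}} (hl : ℵ₀ ≤ l) {δ : Ordinal.{u}}
    (hδ : Order.IsSuccLimit δ) {M : Ordinal.{u} → ZFSet.{u}} {U : ZFSet.{u}}
    (hU : ∀ y, y ∈ U ↔ ∃ ξ < δ, y ∈ M ξ) (hmono : ∀ ζ ξ, ζ ≤ ξ → ξ < δ → M ζ ⊆ M ξ)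
    (hcard : ∀ ξ < δ, (M ξ).card ≤ l) (hwc : ∀ ξ < δ, WeaklyClosed (M ξ))
    {x : Set Ordinal.{u}} (hx : x ⊆ Iio δ) (hxcof : ∀ β < δ, ∃ ξ ∈ x, β ≤ ξ)
    (hxU : ∀ β < δ, ∀ α < l.ord, ∀ K : ZFSet.{u},
      (K : Set ZFSet.{u}) ⊆ ⋃ ζ ∈ x ∩ Iio β, slice (M ζ) α → K ∈ U) :
    WeaklyClosed U := by
  intro τ hτ
  rw [weaklyClosedAt_iff]
  intro I hIU hI
  have hτ' : (Cardinal.lift.{u + 1} τ).IsRegular := hτ.lift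
  have hcov : I ⊆ ⋃ ξ : Iio δ, (M ξ.1 : Set ZFSet.{u}) := fun y hy => by
    obtain ⟨ξ, hξ, hyξ⟩ := (hU y).1 (hIU hy)
    exact mem_iUnion.2 ⟨⟨ξ, hξ⟩, hyξ⟩
  rcases mk_inter_eq_or_forall_subset hτ' hI (F := fun ξ : Iio δ => (M ξ.1 : Set ZFSet.{u}))
    (fun a b hab => hmono a.1 b.1 hab b.2) hcov with ⟨ξ, hξ⟩ | ⟨hlt, -⟩
  · obtain ⟨J, hJ, hJτ, hJM⟩ := weaklyClosedAt_iff.1 (hwc ξ.1 ξ.2 τ hτ) _ inter_subset_right hξ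
    exact ⟨J, hJ.trans inter_subset_left, hJτ,
      fun K hK hKτ => (hU K).2 ⟨ξ.1, ξ.2, hJM K hK hKτ⟩⟩
  have hpos : ∀ y ∈ I, ∃ ξ ∈ x, ∃ α < l.ord, y ∈ slice (M ξ) α := by
    intro y hy
    obtain ⟨ζ, hζ, hyζ⟩ := (hU y).1 (hIU hy)
    obtain ⟨ξ, hξ, hζξ⟩ := hxcof ζ hζ
    exact ⟨ξ, hξ, exists_mem_slice hl (hcard ξ (hx hξ)) (hmono ζ ξ hζξ (hx hξ) hyζ)⟩
  choose! pos hposx idx hidx hslice using hpos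
  -- Small subsets of `I` have bounded positions, since the part of `I` below a bound is small.
  have hbdd : ∀ K ⊆ I, #K < Cardinal.lift.{u + 1} τ → ∃ β < δ, ∀ y ∈ K, pos y < β := by
    intro K hK hKτ
    rcases mk_inter_eq_or_forall_subset hτ' hI (F := fun β : Iio δ => {y | pos y ≤ β.1})
      (fun a b hab y hy => le_trans (b := a.1) hy hab)
      (fun y hy => mem_iUnion.2 ⟨⟨pos y, hx (hposx y hy)⟩, le_refl (pos y)⟩) with ⟨β, hβ⟩ | ⟨-, h⟩
    · have hsub : I ∩ {y | pos y ≤ β.1} ⊆ I ∩ M β.1 := fun y hy =>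
        ⟨hy.1, hmono _ _ hy.2 β.2 (hslice y hy.1).1⟩
      exact absurd ((mk_le_mk_of_subset hsub).trans_lt (hlt β)) (by rw [hβ]; exact lt_irrefl _)
    · obtain ⟨β, hβ⟩ := h K hK hKτ
      exact ⟨Order.succ β.1, hδ.succ_lt β.2, fun y hy => Order.lt_succ_iff.2 (hβ hy)⟩
  have key : ∀ K : ZFSet.{u}, (K : Set ZFSet.{u}) ⊆ I →
      #(K : Set ZFSet.{u}) < Cardinal.lift.{u + 1} τ →
      ∀ α < l.ord, (∀ y ∈ K, idx y ≤ α) → K ∈ U := by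
    intro K hKI hKτ α hα hKα
    obtain ⟨β, hβ, hKβ⟩ := hbdd _ hKI hKτ
    exact hxU β hβ α hα K fun y hy => mem_iUnion₂.2
      ⟨pos y, ⟨hposx y (hKI hy), hKβ y hy⟩, slice_mono _ (hKα y hy) (hslice y (hKI hy))⟩
  rcases mk_inter_eq_or_forall_subset hτ' hI (F := fun α : Iio l.ord => {y | idx y ≤ α.1})
    (fun a b hab y hy => le_trans (b := a.1) hy hab)
    (fun y hy => mem_iUnion.2 ⟨⟨idx y, hidx y hy⟩, le_refl (idx y)⟩) with ⟨α, hα⟩ | ⟨-, h⟩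
  · exact ⟨_, inter_subset_left, hα, fun K hK hKτ =>
      key K (hK.trans inter_subset_left) hKτ α.1 α.2 fun y hy => (hK hy).2⟩
  · refine ⟨I, Subset.rfl, hI, fun K hK hKτ => ?_⟩
    obtain ⟨α, hα⟩ := h K hK hKτ
    exact key K hK hKτ α.1 α.2 fun y hy => hα hy

theorem exists_recursive {β : Type v} [Inhabited β] (step : Ordinal.{u} → (Ordinal.{u} → β) → β)
    (hstep : ∀ ξ N N', (∀ ζ < ξ, N ζ = N' ζ) → step ξ N = step ξ N') :
    ∃ M : Ordinal.{u} → β, ∀ ξ, M ξ = step ξ M := by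
  classical
  refine ⟨WellFounded.fix Ordinal.lt_wf fun ξ N =>
    step ξ fun ζ => if h : ζ < ξ then N ζ h else default, fun ξ => ?_⟩
  rw [WellFounded.fix_eq]
  exact hstep _ _ _ fun ζ hζ => by rw [dif_pos hζ]

/-- What a model at a non-limit stage `ξ` of the chain has to contain: the part of `A` that is due,
the set `B`, the previous models and their initial segments, and the subsets of the small sets
`⋃ ζ ∈ z, slice (N ζ) α` with `z ∈ Q γ` for some `γ < ξ`. -/
def stage (l : Cardinal.{u}) (Q : Ordinal.{u} → Set (Set Ordinal.{u})) (A B : ZFSet.{u})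
    (ξ : Ordinal.{u}) (N : Ordinal.{u} → ZFSet.{u}) : Set ZFSet.{u} :=
  ({B} ∪ slice A ξ ∪ ⋃ ζ ∈ Iio ξ, insert (initialSegment N ζ) (N ζ : Set ZFSet.{u})) ∪
    ⋃ γ ∈ Iio ξ, ⋃ z ∈ Q γ, ⋃ α ∈ Iio l.ord,
      {K : ZFSet.{u} | (K : Set ZFSet.{u}) ⊆ ⋃ ζ ∈ z ∩ Iio ξ, slice (N ζ) α}

theorem initialSegment_congr {N N' : Ordinal.{u} → ZFSet.{u}} {η : Ordinal.{u}}
    (h : ∀ ζ ≤ η, N ζ = N' ζ) : initialSegment N η = initialSegment N' η := by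
  unfold initialSegment
  congr 1
  funext ξ
  rw [h ξ.1 ξ.2]

theorem stage_congr (l : Cardinal.{u}) (Q : Ordinal.{u} → Set (Set Ordinal.{u})) (A B : ZFSet.{u})
    {ξ : Ordinal.{u}} {N N' : Ordinal.{u} → ZFSet.{u}} (h : ∀ ζ < ξ, N ζ = N' ζ) :
    stage l Q A B ξ N = stage l Q A B ξ N' := by
  have h1 : (⋃ ζ ∈ Iio ξ, insert (initialSegment N ζ) (N ζ : Set ZFSet.{u})) =
      ⋃ ζ ∈ Iio ξ, insert (initialSegment N' ζ) (N' ζ : Set ZFSet.{u}) :=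
    iUnion₂_congr fun ζ hζ => by
      rw [h ζ hζ, initialSegment_congr fun ζ' hζ' => h ζ' (lt_of_le_of_lt hζ' hζ)]
  have h2 : ∀ (z : Set Ordinal.{u}) (α : Ordinal.{u}),
      (⋃ ζ ∈ z ∩ Iio ξ, slice (N ζ) α) = ⋃ ζ ∈ z ∩ Iio ξ, slice (N' ζ) α := fun z α =>
    iUnion₂_congr fun ζ hζ => by rw [h ζ hζ.2]
  simp only [stage, h1, h2]

theorem stage_subset_and_mk_le {l Θ : Cardinal.{u}} (hlim : l.IsStrongLimit) (h : IsLarge l Θ)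
    {Q : Ordinal.{u} → Set (Set Ordinal.{u})} {A B : ZFSet.{u}} {ξ : Ordinal.{u}}
    {N : Ordinal.{u} → ZFSet.{u}} (hξ : ξ < (Order.succ l).ord) (hA : ∀ a ∈ A, a ∈ H Θ)
    (hB : B ∈ H Θ) (hN : ∀ ζ < ξ, (∀ y ∈ N ζ, y ∈ H Θ) ∧ (N ζ).card ≤ l)
    (hQ : ∀ α < (Order.succ l).ord, #(Q α) ≤ Cardinal.lift.{u + 1} l ∧
      ∀ z ∈ Q α, #z < Cardinal.lift.{u + 1} l) :
    stage l Q A B ξ N ⊆ H Θ ∧ #(stage l Q A B ξ N) ≤ Cardinal.lift.{u + 1} l := by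
  have hL : ℵ₀ ≤ Cardinal.lift.{u + 1} l := aleph0_le_lift.2 h.aleph0_le
  have hsmall : ∀ γ < ξ, ∀ z ∈ Q γ, ∀ α < l.ord,
      #(⋃ ζ ∈ z ∩ Iio ξ, slice (N ζ) α : Set ZFSet.{u}) < Cardinal.lift.{u + 1} l := by
    intro γ hγ z hz α hα
    refine (mk_biUnion_le _ _).trans_lt (mul_lt_of_lt hL ?_ ?_)
    · exact (mk_le_mk_of_subset inter_subset_left).trans_lt ((hQ γ (hγ.trans hξ)).2 z hz)
    · exact (ciSup_le' fun ζ => mk_slice_le _ _).trans_lt (mk_Iio_lt_lift hα)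
  constructor
  · rintro y (((hy | hy) | hy) | hy)
    · rw [mem_singleton_iff] at hy
      exact hy ▸ hB
    · exact hA y hy.1
    · obtain ⟨ζ, hζ, hy⟩ := mem_iUnion₂.1 hy
      rcases hy with rfl | hy
      · exact h.initialSegment_mem_H (lt_trans hζ hξ) fun ζ' hζ' => hN ζ' (lt_of_le_of_lt hζ' hζ)
      · exact (hN ζ hζ).1 y hy
    · simp only [mem_iUnion] at hy
      obtain ⟨γ, hγ, z, hz, α, hα, hy⟩ := hy
      refine h.mem_H (fun w hw => ?_) ?_
      · obtain ⟨ζ, hζ, hw⟩ := mem_iUnion₂.1 (hy hw)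
        exact (hN ζ hζ.2).1 w hw.1
      · rw [← Cardinal.lift_le.{u + 1}, ← ZFSet.cardinalMk_coe_sort]
        exact (mk_le_mk_of_subset hy).trans (hsmall γ hγ z hz α hα).le
  · have hIio := mk_Iio_le_lift hξ
    refine mk_union_le_of_le hL (mk_union_le_of_le hL (mk_union_le_of_le hL ?_ ?_) ?_) ?_
    · rw [mk_singleton]
      exact one_le_aleph0.trans hL
    · exact (mk_slice_le _ _).trans hIio
    · refine mk_biUnion_le_of_le hL hIio fun ζ hζ => mk_insert_le.trans ?_
      exact (add_le_add (mk_coe_le (hN ζ hζ).2) (one_le_aleph0.trans hL)).trans (add_eq_self hL).le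
    · refine mk_biUnion_le_of_le hL hIio fun γ hγ =>
        mk_biUnion_le_of_le hL (hQ γ (lt_trans hγ hξ)).1 fun z hz =>
        mk_biUnion_le_of_le hL (by rw [Cardinal.mk_Iio_ordinal, card_ord]) fun α hα =>
        mk_subset_le_of_isStrongLimit hlim (hsmall γ hγ z hz α hα)

theorem ceca_of_mem_approachabilityIdeal {l : Cardinal.{u}} (hsing : l.IsSingular)
    (hlim : l.IsStrongLimit)
    (h : Iio (Order.succ l).ord ∈ approachabilityIdeal (Order.succ l)) :
    CECA (Order.succ l) := by
  obtain ⟨Q, hQ, happ⟩ := exists_small_approachability hsing h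
  have hl := hsing.aleph0_le
  have hκlim := isSuccLimit_ord (hl.trans (Order.le_succ l))
  intro Θ hΘ hcofΘ A B hA hB hAcard _
  have hlarge : IsLarge l Θ := ⟨hl, hΘ, hcofΘ⟩
  rw [(isRegular_succ hl).cof_ord]
  have hH : Cardinal.lift.{u + 1} l ≤ #(H Θ) := by
    refine le_trans ?_ (mk_le_mk_of_subset (s := (A : Set ZFSet.{u})) hA)
    have : #(A : Set ZFSet.{u}) = Cardinal.lift.{u + 1} A.card := ZFSet.cardinalMk_coe_sort
    rw [this, hAcard, Cardinal.lift_le]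
    exact Order.le_succ l
  have hhull := fun X : Set ZFSet.{u} => @exists_weaklyClosed_hull l Θ hlim hlarge hH X
  choose! hull hsub_hull hull_elem hull_closed hull_card using hhull
  classical
  obtain ⟨M, hM⟩ := exists_recursive (β := ZFSet.{u}) (fun ξ N =>
    if Order.IsSuccLimit ξ then ZFSet.iUnion fun ζ : Iio ξ => N ζ.1
      else hull (stage l Q A B ξ N)) (by
    intro ξ N N' hNN'
    simp only [stage_congr l Q A B hNN']
    congr 2
    funext ζ
    exact hNN' ζ.1 ζ.2)
  have hMlim : ∀ δ, Order.IsSuccLimit δ → ∀ y, y ∈ M δ ↔ ∃ ξ < δ, y ∈ M ξ := by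
    intro δ hδ y
    rw [hM δ, if_pos hδ, ZFSet.mem_iUnion]
    exact ⟨fun ⟨ξ, hy⟩ => ⟨ξ.1, ξ.2, hy⟩, fun ⟨ξ, hξ, hy⟩ => ⟨⟨ξ, hξ⟩, hy⟩⟩
  have hMsucc : ∀ ξ, ¬ Order.IsSuccLimit ξ → M ξ = hull (stage l Q A B ξ M) := by
    intro ξ hξ
    rw [hM ξ, if_neg hξ]
  have hind : ∀ ξ < (Order.succ l).ord,
      (IsElementarySubmodel (M ξ) Θ ∧ WeaklyClosed (M ξ) ∧ (M ξ).card ≤ l) ∧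
      (∀ ζ < ξ, M ζ ⊆ M ξ) ∧ (¬ Order.IsSuccLimit ξ → stage l Q A B ξ M ⊆ M ξ) := by
    intro ξ
    induction ξ using WellFoundedLT.induction with
    | _ ξ ih =>
    intro hξ
    by_cases hξlim : Order.IsSuccLimit ξ
    · have hmono : ∀ ζ η, ζ ≤ η → η < ξ → M ζ ⊆ M η := by
        intro ζ η hζη hη
        rcases eq_or_lt_of_le hζη with rfl | hlt
        · exact fun _ hy => hy
        · exact (ih η hη (hη.trans hξ)).2.1 ζ hlt
      have hU := hMlim ξ hξlim
      refine ⟨⟨?_, ?_, ?_⟩, fun ζ hζ y hy => (hU y).2 ⟨ζ, hζ, hy⟩, fun hne => absurd hξlim hne⟩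
      · have : Nonempty (Iio ξ) := ⟨⟨0, hξlim.bot_lt⟩⟩
        refine isElementarySubmodel_of_monotone (ι := Iio ξ) (N := fun ζ => M ζ.1)
          (fun a b hab => hmono a.1 b.1 hab b.2) (fun ζ => (ih ζ.1 ζ.2 (lt_trans ζ.2 hξ)).1.1)
          fun y => (hU y).trans ⟨fun ⟨ζ, hζ, hy⟩ => ⟨⟨ζ, hζ⟩, hy⟩, fun ⟨ζ, hy⟩ => ⟨ζ.1, ζ.2, hy⟩⟩
      · obtain ⟨x, hx, hxcof, hxQ⟩ := happ ξ hξ hξlim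
        refine weaklyClosed_of_approachable hl hξlim hU hmono
          (fun ζ hζ => (ih ζ hζ (hζ.trans hξ)).1.2.2) (fun ζ hζ => (ih ζ hζ (hζ.trans hξ)).1.2.1)
          hx hxcof fun β hβ α hα K hK => ?_
        obtain ⟨γ, hγ, hmem⟩ := hxQ β hβ
        have hη : Order.succ (max γ β) < ξ := hξlim.succ_lt (max_lt hγ hβ)
        have hstage := (ih _ hη (hη.trans hξ)).2.2 (Order.not_isSuccLimit_succ _)
        refine (hU K).2 ⟨_, hη, hstage (Or.inr ?_)⟩
        simp only [mem_iUnion]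
        refine ⟨γ, Order.lt_succ_iff.2 (le_max_left γ β), _, hmem, α, hα, fun y hy => ?_⟩
        obtain ⟨ζ, hζ, hyζ⟩ := mem_iUnion₂.1 (hK hy)
        exact mem_iUnion₂.2 ⟨ζ, ⟨hζ, (lt_of_lt_of_le (b := β) hζ.2 (le_max_right _ _)).trans
          (Order.lt_succ _)⟩, hyζ⟩
      · have hle : #(M ξ : Set ZFSet.{u}) ≤ Cardinal.lift.{u + 1} l := by
          refine (mk_le_mk_of_subset (t := ⋃ ζ ∈ Iio ξ, (M ζ : Set ZFSet.{u})) fun y hy => ?_).trans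
            (mk_biUnion_le_of_le (aleph0_le_lift.2 hl) (mk_Iio_le_lift hξ) fun ζ hζ =>
              mk_coe_le (ih ζ hζ (lt_trans hζ hξ)).1.2.2)
          obtain ⟨ζ, hζ, hy⟩ := (hU y).1 hy
          exact mem_iUnion₂.2 ⟨ζ, hζ, hy⟩
        rwa [← Cardinal.lift_le.{u + 1}, ← ZFSet.cardinalMk_coe_sort]
    · obtain ⟨hst, hst_card⟩ := stage_subset_and_mk_le hlim hlarge hξ hA hB
        (fun ζ hζ => ⟨(ih ζ hζ (hζ.trans hξ)).1.1.1, (ih ζ hζ (hζ.trans hξ)).1.2.2⟩)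
        fun α hα => ⟨(hQ α hα).1, fun z hz => ((hQ α hα).2 z hz).2⟩
      rw [hMsucc ξ hξlim]
      refine ⟨⟨hull_elem _ hst hst_card, hull_closed _ hst hst_card, hull_card _ hst hst_card⟩,
        fun ζ hζ y hy => hsub_hull _ hst hst_card ?_, fun _ => hsub_hull _ hst hst_card⟩
      exact Or.inl (Or.inr (mem_iUnion₂.2 ⟨ζ, hζ, Or.inr hy⟩))
  refine ⟨M, fun ξ η hξη hη => ⟨(hind η hη).2.1 ξ hξη, ?_⟩, fun δ _ hδ => hMlim δ hδ,
    fun ξ hξ => ⟨(hind ξ hξ).1.1, (hind ξ hξ).1.2.1, Order.lt_succ_iff.2 (hind ξ hξ).1.2.2⟩, ?_, ?_⟩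
  · rw [← Order.succ_eq_add_one]
    refine (hind _ (hκlim.succ_lt hη)).2.2 (Order.not_isSuccLimit_succ _) ?_
    exact Or.inl (Or.inr (mem_iUnion₂.2 ⟨η, Order.lt_succ η, Or.inl rfl⟩))
  · have hne : ¬ Order.IsSuccLimit (0 : Ordinal.{u}) := fun h0 => h0.bot_lt.ne rfl
    exact (hind 0 hκlim.bot_lt).2.2 hne (Or.inl (Or.inl (Or.inl rfl)))
  · intro a ha
    have hlt : code A a < (Order.succ l).ord := hAcard ▸ code_lt ha
    have hlt' := hκlim.succ_lt hlt
    exact ⟨_, hlt', (hind _ hlt').2.2 (Order.not_isSuccLimit_succ _)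
      (Or.inl (Or.inl (Or.inr ⟨ha, Order.lt_succ _⟩)))⟩

end ClosedChain

theorem corollary1p7 (l : Cardinal.{u}) (hsing : l.IsSingular) (hlim : l.IsStrongLimit) :
    List.TFAE
      [Set.Iio (Order.succ l).ord ∈ ClosedChain.approachabilityIdeal (Order.succ l),
        ∀ τ : Cardinal.{u}, τ.IsRegular → τ < l →
          ClosedChain.cofSet (Order.succ l) τ ∈ ClosedChain.approachabilityIdeal (Order.succ l),
        ClosedChain.CECA (Order.succ l),
        ∀ τ : Cardinal.{u}, τ.IsRegular → τ < l → ClosedChain.CECAAt τ (Order.succ l)] := by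
  tfae_have 1 → 3 := ClosedChain.ceca_of_mem_approachabilityIdeal hsing hlim
  tfae_have 3 → 4 := by
    intro h τ hτ _ Θ hΘ hcof A B hA hB hAcard hBcard
    obtain ⟨M, hchain, hcont, hM, hBM, hAM⟩ := h Θ hΘ hcof A B hA hB hAcard hBcard
    exact ⟨M, hchain, hcont,
      fun ξ hξ => ⟨(hM ξ hξ).1, (hM ξ hξ).2.1 τ hτ, (hM ξ hξ).2.2⟩, hBM, hAM⟩
  tfae_have 4 → 2 := fun h τ hτ hτl =>
    ClosedChain.cofSet_mem_approachabilityIdeal hsing.aleph0_le (h τ hτ hτl)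
  tfae_have 2 → 1 := ClosedChain.mem_approachabilityIdeal_of_forall_cofSet hsing
  tfae_finish
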